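/- **Definition.** Let $(P,\le)$ be a poset and $n$ a non-negative integer. Write $[n]=\{1,\dots,n\}$. A *sub-Taylor polymorphism* of arity $n$ of $P$ is a monotone map $t\colon P^n\to P$ (with $P^n$ ordered componentwise) such that $t(x,\dots,x)\ge x$ for all $x\in P$, together with $n$ binary monotone maps $s_1,\dots,s_n\colon P^2\to P$ such that for every $i\in[n]$ there are fixed functions $\alpha_i,\beta_i\colon[n]\to[2]$ with $\alpha_i(i)\ne\beta_i(i)$ and $$t(x_{\alpha_i(1)},\dots,x_{\alpha_i(n)})\ \ge\ s_i(x_1,x_2),\qquad t(x_{\beta_i(1)},\dots,x_{\beta_i(n)})\ \ge\ s_i(x_1,x_2)$$ for all $x_1,x_2\in P$. The *geometric realization* $|P|$ of a finite poset $P$ is the geometric realization of its order complex, i.e. of the simplicial complex whose vertices are the elements of $P$ and whose faces are the chains of $P$: the elements of $P$ are identified with the standard basis vectors of $\mathbb R^P$, and $|P|\subseteq\mathbb R^P$ is the union of the convex hulls of the nonempty chains, with the subspace topology. In particular $P\subseteq|P|$. **Theorem.** Let $P$ be a finite poset that has a sub-Taylor polymorphism (of some arity $n$). Then $\pi_d(|P|,p_0)=0$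 for all $d\ge 1$ and all $p_0\in P$. -/

import Mathlib

/-- A sub-Taylor polymorphism of arity `n` of a poset `P`: a monotone map `t : Pⁿ → P` with
`t(x, …, x) ≥ x`, together with binary monotone maps `s₁, …, sₙ : P² → P` such that, for each `i`,
there are fixed functions `α, β : [n] → [2]` with `α i ≠ β i` and
`t(x_{α 1}, …, x_{α n}) ≥ sᵢ(x₁, x₂)`, `t(x_{β 1}, …, x_{β n}) ≥ sᵢ(x₁, x₂)` for all `x₁, x₂`. -/
structure SubTaylorPolymorphism (P : Type*) [PartialOrder P] (n : ℕ) where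
  t : (Fin n → P) →o P
  s : Fin n → ((Fin 2 → P) →o P)
  le_diag : ∀ x : P, x ≤ t (fun _ => x)
  sub_taylor : ∀ i : Fin n, ∃ α β : Fin n → Fin 2, α i ≠ β i ∧
    ∀ x : Fin 2 → P,
      s i x ≤ t (fun j => x (α j)) ∧ s i x ≤ t (fun j => x (β j))

/-- The order complex of a poset: its vertices are the elements of `P`, and its (nonempty) faces
are the nonempty finite chains of `P`. -/
def orderComplex (P : Type*) [PartialOrder P] : AbstractSimplicialComplex P where
  faces := {F | F.Nonempty ∧ IsChain (· ≤ ·) (F : Set P)}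
  isRelLowerSet_faces := fun _ hF =>
    ⟨hF.1, fun _ hGF hG => ⟨hG, hF.2.mono (Finset.coe_subset.2 hGF)⟩⟩
  singleton_mem := fun v => ⟨Finset.singleton_nonempty v, by simp⟩

namespace AbstractSimplicialComplex

open scoped Classical in
/-- The geometric simplicial complex of a finite abstract simplicial complex: the vertices are
placed at the standard basis vectors of the finite-dimensional real vector space `ℝ^V`, which are
affinely independent, hence in general position. -/
noncomputable def geometric {V : Type*} [Finite V] (K : AbstractSimplicialComplex V) :
    Geometry.SimplicialComplex ℝ (V → ℝ) :=
  Geometry.SimplicialComplex.ofAffineIndependent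
    (K.toPreAbstractSimplicialComplex.map (fun v => (Pi.single v 1 : V → ℝ)))
    (by
      refine (Pi.linearIndependent_single_one V ℝ).affineIndependent.range.mono fun x hx => ?_
      simp only [Set.mem_iUnion, Finset.mem_coe] at hx
      obtain ⟨_, ⟨_, _, rfl⟩, hx⟩ := hx
      grind)

end AbstractSimplicialComplex

/-- The geometric realization `|P|` of a finite poset `P`: the union of the geometric simplices
`conv(F)` over all faces `F` of the order complex of `P`, with the subspace topology from `ℝ^P`. -/
abbrev PosetRealization (P : Type*) [PartialOrder P] [Finite P] : Type _ :=
  ((orderComplex P).geometric.space : Set (P → ℝ))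

open scoped Classical in
/-- An element of `P`, regarded as a vertex of `|P|`. -/
noncomputable def PosetRealization.vertex {P : Type*} [PartialOrder P] [Finite P] (p : P) :
    PosetRealization P :=
  ⟨Pi.single p 1, Geometry.SimplicialComplex.mem_space_iff.2
    ⟨{Pi.single p 1}, ⟨{p}, (orderComplex P).singleton_mem p, by simp⟩, by simp⟩⟩

open scoped Topology

/-!
The proof is by induction on the size of `P`. Retracts of `P` inherit a sub-Taylor polymorphism
(`SubTaylorPolymorphism.fixed`), so all proper retracts of `P` may be assumed to have trivial
homotopy groups. This allows two reductions and has one consequence.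

* `P` is a core, i.e. no monotone self-map except the identity is comparable to the identity:
  otherwise a power of such a map is a retraction onto a proper subset that is homotopic to the
  identity (`PosetRealization.loopsTrivial_of_not_isCore`). The homotopy moves the base point,
  which is repaired by `GenLoop.homotopic_const_of_homotopyWith`.
* `P` is connected: otherwise the other components can be collapsed to the base point
  (`PosetRealization.homotopic_const_of_not_connectedFrom`).
* A monotone self-map `f` that fixes `p` and is not an automorphism acts nilpotently on `π_d`, since
  a power of `f` is a retraction onto a proper subset. If `b` is a binary operation with
  `b(x, x) = x`, then `γ = b(p, γ) · b(γ, p)` in `π_d`. So if `π_d` is nontrivial, the translations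
  `b(·, p)` and `b(p, ·)` cannot both be nilpotent, and one of them is an automorphism
  (`PosetRealization.bijective_or_bijective`).

The rest is combinatorics (`FinitePoset.subsingleton_of_isCore`). In a core, `t(x, …, x) = x`. Call a
set `J` of coordinates of `t` big if putting `x` in the coordinates in `J` and `p` elsewhere gives an
automorphism; connectedness and the core property then imply that `t` takes the value `x` whenever
all coordinates in `J` are `x`. The set of all coordinates is big, and by the statement on binary
operations a disjoint union of two sets that are not big is not big. Hence some `{i}` is big, and so
no set avoiding `i` is big. The inequality `sᵢ(x₁, x₂) ≤ t(x_{α 1}, …, x_{α n}) = x_{α i}` forces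
equality because `P` is a core, and then `x_{α i} ≤ t(x_{β 1}, …, x_{β n})` makes
`{j | β j = α i}` big, although it does not contain `i`. So `P` has just one point.

To let binary operations act on realizations, a point of `|P|` is regarded as a probability vector
supported on a chain, and `|A| × |B| → |A × B|` sends two such vectors to their comonotone coupling
(`PosetRealization.pair`): laying out the weights of a vector as consecutive intervals of `[0, 1]` in
the order of the chain, the weight of `(a, b)` is the length of the intersection of the intervals of
`a` and `b`.
-/

/-! ### Monotone self-maps of finite posets -/

/-- Some positive power of an element of a finite monoid is idempotent. -/
theorem exists_pow_idempotent {M : Type*} [Monoid M] [Finite M] (a : M) :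
    ∃ N : ℕ, 0 < N ∧ a ^ N * a ^ N = a ^ N := by
  obtain ⟨i, j, hij, h⟩ := Finite.exists_ne_map_eq_of_infinite (fun k : ℕ => a ^ k)
  wlog hlt : i < j generalizing i j
  · exact this j i hij.symm h.symm (by omega)
  obtain ⟨p, rfl⟩ := Nat.exists_eq_add_of_lt hlt
  have step : ∀ k, i ≤ k → a ^ (k + (p + 1)) = a ^ k := fun k hk => by
    obtain ⟨c, rfl⟩ := Nat.exists_eq_add_of_le hk
    calc a ^ (i + c + (p + 1)) = a ^ (i + p + 1) * a ^ c := by rw [← pow_add]; congr 1; ring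
      _ = a ^ (i + c) := by rw [← show a ^ i = a ^ (i + p + 1) from h, ← pow_add]
  have mult : ∀ m k, i ≤ k → a ^ (k + m * (p + 1)) = a ^ k := fun m => by
    induction m with
    | zero => simp
    | succ m ih =>
      intro k hk
      rw [show k + (m + 1) * (p + 1) = (k + m * (p + 1)) + (p + 1) by ring,
        step _ (by omega), ih k hk]
  -- a multiple of the period `p + 1` that is at least the preperiod `i`
  refine ⟨(i + 1) * (p + 1), by positivity, ?_⟩
  rw [← pow_add]
  exact mult (i + 1) _ (by nlinarith)

namespace FinitePoset

variable {P : Type*} [PartialOrder P]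

instance [Finite P] : Finite (P →o P) := DFunLike.finite _

/-- A poset is a core if no monotone self-map other than the identity is comparable to the
identity. For finite posets this means that there are no beat points. -/
def IsCore (P : Type*) [PartialOrder P] : Prop :=
  ∀ g : P →o P, ((∀ x, x ≤ g x) ∨ ∀ x, g x ≤ x) → ∀ x, g x = x

/-- The comparability graph of `P` is connected, in the form of an induction principle starting
at `p₀`: a set that contains `p₀` and is both upward and downward closed is everything. -/
def ConnectedFrom (p₀ : P) : Prop :=
  ∀ U : Set P, p₀ ∈ U → (∀ x y, x ≤ y → (x ∈ U ↔ y ∈ U)) → ∀ x, x ∈ U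

theorem exists_pow_eq_one_of_bijective [Finite P] {σ : P →o P} (hσ : Function.Bijective σ) :
    ∃ N, σ ^ (N + 1) = 1 := by
  obtain ⟨N, hN, h⟩ := exists_pow_idempotent σ
  have hbij : Function.Injective (σ ^ N : P →o P) := by
    have : ⇑(σ ^ N : P →o P) = σ^[N] := by
      clear h hN
      induction N with
      | zero => rfl
      | succ N ih => rw [pow_succ, Function.iterate_succ, ← ih]; rfl
    rw [this]; exact hσ.1.iterate N
  obtain ⟨k, rfl⟩ := Nat.exists_eq_succ_of_ne_zero hN.ne'
  exact ⟨k, OrderHom.ext _ _ (funext fun x => hbij (DFunLike.congr_fun h x))⟩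

/-- On a finite core, an automorphism is comparable only to itself. -/
theorem IsCore.eq_of_bijective [Finite P] (hP : IsCore P) {σ g : P →o P}
    (hσ : Function.Bijective σ) (h : (∀ x, σ x ≤ g x) ∨ ∀ x, g x ≤ σ x) (x : P) : g x = σ x := by
  obtain ⟨N, hN⟩ := exists_pow_eq_one_of_bijective hσ
  have inv : ∀ y, (σ ^ N : P →o P) (σ y) = y := fun y => DFunLike.congr_fun hN y
  have key : ∀ y, ((σ ^ N : P →o P).comp g) y = y := by
    refine hP _ (h.imp (fun h y => ?_) fun h y => ?_)
    · simpa [inv] using (σ ^ N : P →o P).monotone (h y)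
    · simpa [inv] using (σ ^ N : P →o P).monotone (h y)
  have inv' : ∀ y, σ ((σ ^ N : P →o P) y) = y := fun y => by
    have := DFunLike.congr_fun ((pow_succ' σ N).symm.trans hN) y
    exact this
  rw [← inv' (g x)]
  exact congrArg σ (key x)

/-! ### Sub-Taylor polymorphisms of a connected core -/

open Classical in
/-- The unary map obtained from `t` by putting the variable in the coordinates in `J` and the
constant `y` elsewhere. -/
def freeze {n : ℕ} (t : (Fin n → P) →o P) (J : Finset (Fin n)) (y : P) : P →o P where
  toFun x := t (J.piecewise (fun _ => x) fun _ => y)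
  monotone' _ _ h := t.monotone (Finset.piecewise_le_piecewise _ (fun _ => h) le_rfl)

open Classical in
/-- If freezing the coordinates outside `J` leaves an automorphism, then `t` ignores those
coordinates: all of them may be varied independently, because the poset is connected and an
automorphism of a core is comparable only to itself. -/
theorem eq_of_bijective_freeze [Finite P] (hP : IsCore P) {p₀ : P} (hconn : ConnectedFrom p₀)
    {n : ℕ} (t : (Fin n → P) →o P) (ht : ∀ x, t (fun _ => x) = x) {J : Finset (Fin n)}
    (hJ : Function.Bijective (freeze t J p₀)) (z : Fin n → P) (x : P) :
    t (J.piecewise (fun _ => x) z) = x := by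
  have key : ∀ (K : Finset (Fin n)) (z : Fin n → P) (x : P),
      t (J.piecewise (fun _ => x) (K.piecewise z fun _ => p₀)) = freeze t J p₀ x := by
    intro K
    induction K using Finset.induction with
    | empty => intro z x; simp only [Finset.piecewise_empty]; rfl
    | insert k K hk ih =>
      intro z x
      have h := hconn {y | ∀ x, t (J.piecewise (fun _ => x) ((insert k K).piecewise
        (Function.update z k y) fun _ => p₀)) = freeze t J p₀ x} ?_ ?_ (z k)
      · simpa using h x
      · intro x
        rw [← ih z x]
        congr 2
        ext i
        by_cases hik : i = k
        · subst hik; simp [hk]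
        · simp [Finset.piecewise, Finset.mem_insert, hik]
      · intro y y' hyy
        let g : P → (P →o P) := fun y =>
          { toFun := fun x => t (J.piecewise (fun _ => x) ((insert k K).piecewise
              (Function.update z k y) fun _ => p₀))
            monotone' := fun _ _ h =>
              t.monotone (Finset.piecewise_le_piecewise _ (fun _ => h) le_rfl) }
        have hg : ∀ x, g y x ≤ g y' x := fun x =>
          t.monotone (Finset.piecewise_le_piecewise _ le_rfl
            (Finset.piecewise_le_piecewise _ (update_le_update_iff.2
              ⟨hyy, fun _ _ => le_rfl⟩) le_rfl))
        constructor
        · intro h x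
          exact hP.eq_of_bijective hJ (g := g y') (Or.inl fun x => (h x) ▸ hg x) x
        · intro h x
          exact hP.eq_of_bijective hJ (g := g y) (Or.inr fun x => (h x) ▸ hg x) x
  have key' : ∀ (z : Fin n → P) (x : P), t (J.piecewise (fun _ => x) z) = freeze t J p₀ x :=
    fun z x => by simpa using key Finset.univ z x
  rw [key' z x, ← key' (fun _ => x) x, Finset.piecewise_same]
  exact ht x

open Classical in
/-- The combinatorial heart. Call a set `J` of coordinates big if freezing the other coordinates of
`t` at `p₀` gives an automorphism. If binary idempotent operations always have a big coordinate,
then some singleton `{i}` is big and no set avoiding `i` is; this contradicts the `i`-th sub-Taylor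
inequality, unless there is only one point. -/
theorem subsingleton_of_isCore [Finite P] (hP : IsCore P) {p₀ : P} (hconn : ConnectedFrom p₀)
    (hbin : ∀ b : P × P →o P, (∀ x, b (x, x) = x) →
      Function.Bijective (fun x => b (x, p₀)) ∨ Function.Bijective (fun x => b (p₀, x)))
    {n : ℕ} (T : SubTaylorPolymorphism P n) : Subsingleton P := by
  have ht : ∀ x, T.t (fun _ => x) = x :=
    hP ⟨fun x => T.t fun _ => x, fun _ _ h => T.t.monotone fun _ => h⟩ (Or.inl T.le_diag)
  let big : Finset (Fin n) → Prop := fun J => Function.Bijective (freeze T.t J p₀)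
  have big_eq : ∀ {J}, big J → ∀ z x, T.t (J.piecewise (fun _ => x) z) = x :=
    fun hJ => eq_of_bijective_freeze hP hconn T.t ht hJ
  by_contra hns
  rw [not_subsingleton_iff_nontrivial] at hns
  have not_big_empty : ¬ big ∅ := fun h => by
    obtain ⟨x, y, hxy⟩ := exists_pair_ne P
    exact hxy (h.1 (by simp [freeze]))
  have not_big_union : ∀ J K, Disjoint J K → ¬ big J → ¬ big K → ¬ big (J ∪ K) := by
    intro J K hJK hJ hK hU
    let b : P × P →o P :=
      { toFun := fun q => T.t (J.piecewise (fun _ => q.1) (K.piecewise (fun _ => q.2) fun _ => p₀))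
        monotone' := fun q q' h => T.t.monotone (Finset.piecewise_le_piecewise _ (fun _ => h.1)
          (Finset.piecewise_le_piecewise _ (fun _ => h.2) le_rfl)) }
    have b_left : (fun x => b (x, p₀)) = freeze T.t J p₀ := by
      funext x
      exact congrArg (fun z => T.t (J.piecewise (fun _ => x) z)) (Finset.piecewise_same ..)
    have b_right : (fun x => b (p₀, x)) = freeze T.t K p₀ := by
      funext x
      refine congrArg T.t (funext fun i => ?_)
      by_cases hi : i ∈ J
      · simp [hi, Finset.disjoint_left.1 hJK hi]
      · simp [hi, Finset.piecewise]
    have b_diag : ∀ x, b (x, x) = x := fun x => by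
      refine Eq.trans (congrArg T.t (funext fun i => ?_)) (big_eq hU (fun _ => p₀) x)
      by_cases hi : i ∈ J <;> by_cases hk : i ∈ K <;> simp [hi, hk, Finset.piecewise]
    rcases hbin b b_diag with h | h
    · rw [b_left] at h; exact hJ h
    · rw [b_right] at h; exact hK h
  have big_of_eq : ∀ J, (∀ x, freeze T.t J p₀ x = x) → big J := fun J h => by
    have h_id : ⇑(freeze T.t J p₀) = id := funext h
    change Function.Bijective (freeze T.t J p₀)
    rw [h_id]
    exact Function.bijective_id
  -- the set of all coordinates is big and is a disjoint union of singletons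
  obtain ⟨i, hi⟩ : ∃ i, big {i} := by
    by_contra! h
    have all : ∀ J, ¬ big J := fun J => by
      induction J using Finset.induction with
      | empty => exact not_big_empty
      | insert k K hk ih =>
        rw [Finset.insert_eq]
        exact not_big_union _ _ (by simpa using hk) (h k) ih
    exact all Finset.univ (big_of_eq _ fun x => by simpa [freeze] using ht x)
  have not_big : ∀ J, i ∉ J → ¬ big J := fun J hiJ hJ => by
    obtain ⟨x, y, hxy⟩ := exists_pair_ne P
    refine hxy ((big_eq hJ (fun _ => y) x).symm.trans
      (Eq.trans (congrArg T.t (funext fun j => ?_)) (big_eq hi (J.piecewise (fun _ => x) fun _ => y) y)))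
    by_cases hj : j = i
    · subst hj; simp [hiJ]
    · simp [hj, Finset.piecewise]
  obtain ⟨α, β, hαβ, h⟩ := T.sub_taylor i
  -- bigness of `{i}` forces `s i` below the projection to its `α i`-th variable
  have s_le : ∀ x, T.s i x ≤ x (α i) := fun x => by
    refine (h x).1.trans_eq (Eq.trans (congrArg T.t (funext fun j => ?_))
      (big_eq hi (fun j => x (α j)) (x (α i))))
    by_cases hj : j = i
    · subst hj; simp
    · simp [hj, Finset.piecewise]
  let g : P →o P :=
    { toFun := fun y => T.s i (Function.update (fun _ => p₀) (α i) y)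
      monotone' := fun _ _ h => (T.s i).monotone
        (update_le_update_iff.2 ⟨h, fun _ _ => le_rfl⟩) }
  have hg : ∀ y, g y = y := hP g (Or.inr fun y =>
    (s_le (Function.update (fun _ => p₀) (α i) y)).trans_eq (by simp))
  -- so the coordinates where `β` agrees with `α i` form a big set, although `i` is not among them
  refine not_big (Finset.univ.filter fun j => β j = α i) (by simpa using hαβ.symm)
    (big_of_eq _ (hP _ (Or.inl fun y => ?_)))
  refine (hg y).symm.le.trans ((h _).2.trans_eq (congrArg T.t (funext fun j => ?_)))
  by_cases hj : β j = α i
  · simp [hj]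
  · simp [hj, Finset.piecewise]

end FinitePoset

/-! ### Generalized loops -/

namespace GenLoop

open scoped unitInterval Topology.Homotopy

variable {N X Y Z : Type*} [TopologicalSpace X] [TopologicalSpace Y] [TopologicalSpace Z]

/-- The image of a generalized loop under a continuous map. -/
def map {x : X} {y : Y} (φ : C(X, Y)) (h : φ x = y) (γ : Ω^ N X x) : Ω^ N Y y :=
  ⟨φ.comp γ.1, fun z hz => (congrArg φ (γ.2 z hz)).trans h⟩

@[simp]
theorem map_apply {x : X} {y : Y} (φ : C(X, Y)) (h : φ x = y) (γ : Ω^ N X x) (z : I^N) :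
    map φ h γ z = φ (γ z) := rfl

theorem Homotopic.map {x : X} {y : Y} (φ : C(X, Y)) (h : φ x = y) {γ γ' : Ω^ N X x}
    (H : Homotopic γ γ') : Homotopic (map φ h γ) (map φ h γ') :=
  ContinuousMap.HomotopicRel.comp_continuousMap H φ

theorem map_const {x : X} {y : Y} (φ : C(X, Y)) (h : φ x = y) :
    map φ h (const : Ω^ N X x) = const := by
  ext z; simpa using h

theorem Homotopic.map_const {x : X} {y : Y} (φ : C(X, Y)) (h : φ x = y) {γ : Ω^ N X x}
    (H : Homotopic γ const) : Homotopic (GenLoop.map φ h γ) const :=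
  GenLoop.map_const (N := N) φ h ▸ H.map φ h

theorem iterate_map_apply {x : X} (φ : C(X, X)) (h : φ x = x) (k : ℕ) (γ : Ω^ N X x) (y : I^N) :
    (map φ h)^[k] γ y = φ^[k] (γ y) := by
  induction k with
  | zero => rfl
  | succ k ih => rw [Function.iterate_succ_apply', Function.iterate_succ_apply', map_apply, ih]

/-- A map on the cube is constant on the boundary, with an unspecified value. -/
def ConstOnBoundary (f : C(I^N, X)) : Prop := ∃ a, ∀ y ∈ Cube.boundary N, f y = a

/-- The distance of a point of the cube to the boundary. -/
noncomputable def depth [Fintype N] (y : I^N) : I := Finset.univ.inf fun i => y i ⊓ σ (y i)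

theorem continuous_depth [Fintype N] : Continuous (depth : (I^N) → I) :=
  Continuous.finset_inf_apply fun i _ => by fun_prop

theorem depth_eq_zero [Fintype N] {y : I^N} (hy : y ∈ Cube.boundary N) : depth y = 0 := by
  obtain ⟨i, hi⟩ := hy
  refine le_antisymm ((Finset.inf_le (Finset.mem_univ i)).trans ?_) bot_le
  rcases hi with hi | hi <;> simp [hi]

/-- A free null homotopy can be replaced by one that fixes the base point: the boundary of the cube
drags the track of the base point behind it, and this track is then pulled back. -/
theorem homotopic_const_of_homotopyWith [Finite N] [Nonempty N] {x c : X} {γ : Ω^ N X x}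
    (F : ContinuousMap.HomotopyWith γ.1 (ContinuousMap.const _ c) ConstOnBoundary) :
    Homotopic γ const := by
  have := Fintype.ofFinite N
  obtain ⟨i₀⟩ := ‹Nonempty N›
  have hzero : (0 : I^N) ∈ Cube.boundary N := ⟨i₀, Or.inl rfl⟩
  have hF : ∀ s, ∀ y ∈ Cube.boundary N, F (s, y) = F (s, 0) := fun s y hy => by
    obtain ⟨a, ha⟩ := F.prop s
    exact (ha y hy).trans (ha 0 hzero).symm
  have hF0 : F (0, 0) = x := (F.apply_zero _).trans (γ.2 _ hzero)
  let τ : I × (I^N) → I := fun p => p.1 ⊓ Set.projIcc (0 : ℝ) 1 zero_le_one (4 * (depth p.2 : ℝ))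
  have hτc : Continuous τ := by
    have := continuous_depth (N := N)
    exact continuous_fst.inf (continuous_projIcc.comp (by fun_prop))
  have hτ : ∀ s, ∀ y ∈ Cube.boundary N, τ (s, y) = 0 := fun s y hy => by
    simp [τ, depth_eq_zero hy]
  -- the dilation of the cube from its centre by the factor `1 + s`, clamped to the cube
  let κ : I × (I^N) → (I^N) := fun p i =>
    Set.projIcc (0 : ℝ) 1 zero_le_one (1 / 2 + (1 + (p.1 : ℝ)) * ((p.2 i : ℝ) - 1 / 2))
  have hκc : Continuous κ := by
    refine continuous_pi fun i => continuous_projIcc.comp ?_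
    fun_prop
  have hκ0 : ∀ y, κ (0, y) = y := fun y => by
    funext i
    simp only [κ]
    convert! Set.projIcc_val (zero_le_one (α := ℝ)) (y i) using 2
    simp
  have hκ : ∀ s, ∀ y ∈ Cube.boundary N, κ (s, y) ∈ Cube.boundary N := by
    rintro s y ⟨i, hi⟩
    have := s.2.1
    refine ⟨i, hi.imp (fun hi => ?_) fun hi => ?_⟩
    · refine Set.projIcc_of_le_left _ ?_
      simp only [hi, Set.Icc.coe_zero]; linarith
    · refine Set.projIcc_of_right_le _ ?_
      simp only [hi, Set.Icc.coe_one]; linarith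
  -- at time `1` the image of `(τ, κ)` lies where `F` is the track of the base point
  have hκ1 : ∀ y, τ (1, y) = 1 ∨ κ (1, y) ∈ Cube.boundary N := fun y => by
    by_cases h : ∃ i, ((y i ⊓ σ (y i) : I) : ℝ) < 1 / 4
    · obtain ⟨i, hi⟩ := h
      refine Or.inr ⟨i, ?_⟩
      rcases min_lt_iff.1 (show min (y i : ℝ) (1 - y i) < 1 / 4 by simpa using hi) with h | h
      · refine Or.inl (Set.projIcc_of_le_left _ ?_)
        simp only [Set.Icc.coe_one]; linarith
      · refine Or.inr (Set.projIcc_of_right_le _ ?_)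
        simp only [Set.Icc.coe_one]; linarith
    · push Not at h
      left
      have hd : (⟨1 / 4, by norm_num, by norm_num⟩ : I) ≤ depth y :=
        Finset.le_inf fun i _ => h i
      have hd' : (1 / 4 : ℝ) ≤ depth y := hd
      simp only [τ]
      rw [Set.projIcc_of_right_le _ (by linarith)]
      exact inf_of_le_left le_rfl
  -- the end of the first homotopy: it runs through the track `s ↦ F (s, 0)` of the base point
  let track : Ω^ N X x := ⟨⟨fun y => F (τ (1, y), 0), by fun_prop⟩, fun y hy => by
    simp [hτ 1 y hy, hF0]⟩
  have h1 : Homotopic γ track := by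
    refine ⟨⟨⟨⟨fun p => F (τ p, κ p), by fun_prop⟩, fun y => ?_, fun y => ?_⟩, fun s y hy => ?_⟩⟩
    · have : τ (0, y) = 0 := by simp only [τ]; exact inf_of_le_left bot_le
      simp [this, hκ0]
    · rcases hκ1 y with h | h
      · simp [track, h]
      · simpa [track] using hF _ _ h
    · change F (τ (s, y), κ (s, y)) = γ.1 y
      rw [hτ s y hy, hF _ _ (hκ s y hy), hF0]
      exact (γ.2 y hy).symm
  have h2 : Homotopic track const := by
    refine ⟨⟨⟨⟨fun p => F (σ p.1 ⊓ τ (1, p.2), 0), ?_⟩, fun y => ?_, fun y => ?_⟩,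
      fun s y hy => ?_⟩⟩
    · have : Continuous fun p : I × (I^N) => σ p.1 ⊓ τ (1, p.2) :=
        (unitInterval.continuous_symm.comp continuous_fst).inf (by fun_prop)
      fun_prop
    · have : σ (0 : I) ⊓ τ (1, y) = τ (1, y) := by
        rw [unitInterval.symm_zero]; exact inf_of_le_right le_top
      change F (σ 0 ⊓ τ (1, y), 0) = F (τ (1, y), 0)
      rw [this]
    · have : σ (1 : I) ⊓ τ (1, y) = 0 := by
        rw [unitInterval.symm_one]; exact inf_of_le_left bot_le
      change F (σ 1 ⊓ τ (1, y), 0) = x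
      rw [this, hF0]
    · have : σ s ⊓ τ (1, y) = 0 := by rw [hτ 1 y hy]; exact inf_of_le_right bot_le
      change F (σ s ⊓ τ (1, y), 0) = track.1 y
      rw [this, hF0]
      exact (track.2 y hy).symm
  exact h1.trans h2

variable {x : X}

section Binary

variable {β : C(X × X, X)} {f g : C(X, X)}

/-- For an idempotent binary operation `β` with the translations `f = β(·, x)` and `g = β(x, ·)`,
each class satisfies `γ = g(γ) · f(γ)` in the homotopy group; so a loop killed by `f` is fixed
by `g`, because `(γ, γ)` is homotopic to the concatenation of `(γ, x)` and `(x, γ)`. -/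
theorem homotopic_map_of_homotopic_const [Nonempty N] (hβ : ∀ z, β (z, z) = z)
    (hf : ∀ z, β (z, x) = f z) (hg : ∀ z, β (x, z) = g z) (hfx : f x = x) (hgx : g x = x)
    {γ : Ω^ N X x} (hγ : Homotopic (map f hfx γ) const) : Homotopic γ (map g hgx γ) := by
  classical
  let i : N := Classical.arbitrary N
  let cls : Ω^ N X x → HomotopyGroup N X x := Quotient.mk _
  have exact' {p q : Ω^ N X x} (h : cls p = cls q) : Homotopic p q := Quotient.exact h
  have mul_spec (p q : Ω^ N X x) : cls p * cls q = cls (transAt i q p) :=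
    HomotopyGroup.mul_spec
  have h1 : Homotopic γ (transAt i γ const) :=
    exact' ((one_mul (cls γ)).symm.trans (mul_spec _ _))
  have h2 : Homotopic γ (transAt i const γ) :=
    exact' ((mul_one (cls γ)).symm.trans (mul_spec _ _))
  have h3 : Homotopic γ (transAt i (map f hfx γ) (map g hgx γ)) := by
    obtain ⟨H1⟩ := h1
    obtain ⟨H2⟩ := h2
    have hc : Continuous fun p : I × (I^N) => β (H1 p, H2 p) :=
      β.continuous.comp (H1.continuous.prodMk H2.continuous)
    refine ⟨⟨⟨⟨fun p => β (H1 p, H2 p), hc⟩, fun y => ?_, fun y => ?_⟩, fun s y hy => ?_⟩⟩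
    · change β (H1 (0, y), H2 (0, y)) = γ.1 y
      rw [H1.apply_zero, H2.apply_zero, hβ]
    · change β (H1 (1, y), H2 (1, y)) = _
      rw [H1.apply_one, H2.apply_one]
      simp only [coe_coe, transAt, coe_copy]
      split_ifs <;> simp [hf, hg]
    · change β (H1 (s, y), H2 (s, y)) = γ.1 y
      rw [H1.eq_fst s hy, H2.eq_fst s hy, hβ]
  refine h3.trans (exact' ?_)
  have h4 : cls (map f hfx γ) = cls const := Quotient.sound hγ
  refine (mul_spec (map g hgx γ) (map f hfx γ)).symm.trans ?_
  rw [h4]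
  exact mul_one (cls (map g hgx γ))

/-- If iterating each of the two translations of an idempotent binary operation kills all loops,
then all loops are null homotopic. -/
theorem homotopic_const_of_iterate [Nonempty N] (hβ : ∀ z, β (z, z) = z)
    (hf : ∀ z, β (z, x) = f z) (hg : ∀ z, β (x, z) = g z) (hfx : f x = x) (hgx : g x = x)
    {k l : ℕ} (hk : ∀ γ : Ω^ N X x, Homotopic ((map f hfx)^[k] γ) const)
    (hl : ∀ γ : Ω^ N X x, Homotopic ((map g hgx)^[l] γ) const) (γ : Ω^ N X x) :
    Homotopic γ const := by
  have ker : ∀ γ : Ω^ N X x, Homotopic (map f hfx γ) const → Homotopic γ const := fun γ hγ => by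
    have h1 := homotopic_map_of_homotopic_const hβ hf hg hfx hgx hγ
    have h2 : ∀ m, Homotopic γ ((map g hgx)^[m] γ) := fun m => by
      induction m with
      | zero => exact .refl _
      | succ m ih =>
        rw [Function.iterate_succ_apply']
        exact h1.trans (ih.map g hgx)
    exact (h2 l).trans (hl γ)
  have : ∀ m, Homotopic ((map f hfx)^[m] γ) const → Homotopic γ const := fun m => by
    induction m with
    | zero => exact id
    | succ m ih =>
      rw [Function.iterate_succ_apply']
      exact fun h => ih (ker _ h)
  exact this k (hk γ)

end Binary

end GenLoop

/-! ### Points of the realization as chain-supported probability vectors -/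

namespace PosetRealization

open Finset

variable {A B C : Type*} [PartialOrder A] [PartialOrder B] [PartialOrder C]

/-- The realization consists of the probability vectors whose support is a chain. -/
theorem mem_space_iff [Fintype A] {x : A → ℝ} :
    x ∈ (orderComplex A).geometric.space ↔
      (∀ a, 0 ≤ x a) ∧ ∑ a, x a = 1 ∧ IsChain (· ≤ ·) (Function.support x) := by
  classical
  rw [Geometry.SimplicialComplex.mem_space_iff]
  constructor
  · rintro ⟨_, ⟨F, hF, rfl⟩, hx⟩
    have hconv : Convex ℝ (stdSimplex ℝ A ∩ {x : A → ℝ | ∀ a ∉ F, x a = 0}) := by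
      refine (convex_stdSimplex ℝ A).inter ?_
      intro x hx y hy s t _ _ _ a ha
      simp [hx a ha, hy a ha]
    have hsub : ((F.image fun a => (Pi.single a 1 : A → ℝ) : Finset (A → ℝ)) : Set (A → ℝ)) ⊆
        stdSimplex ℝ A ∩ {x : A → ℝ | ∀ a ∉ F, x a = 0} := by
      intro z hz
      obtain ⟨a, ha, rfl⟩ := by simpa using hz
      refine ⟨single_mem_stdSimplex ℝ a, fun b hb => ?_⟩
      simp [show b ≠ a by rintro rfl; exact hb ha]
    have hx' : x ∈ stdSimplex ℝ A ∩ {x : A → ℝ | ∀ a ∉ F, x a = 0} := by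
      refine convexHull_min hsub hconv ?_
      convert hx
    refine ⟨hx'.1.1, hx'.1.2, hF.2.mono fun a ha => ?_⟩
    by_contra h
    exact ha (hx'.2 a h)
  · rintro ⟨h0, h1, hc⟩
    let F : Finset A := univ.filter fun a => x a ≠ 0
    have hsum : ∑ a ∈ F, x a = 1 := by rw [← h1, sum_filter_ne_zero]
    have hF : F.Nonempty := by
      by_contra h
      rw [not_nonempty_iff_eq_empty] at h
      simp [h] at hsum
    refine ⟨F.image fun a => (Pi.single a 1 : A → ℝ), ⟨F, ⟨hF, ?_⟩, ?_⟩, ?_⟩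
    · convert! hc; ext a; simp [F]
    · simp; congr!
    · have hx : x = ∑ a ∈ F, x a • (Pi.single a 1 : A → ℝ) := by
        ext b
        simp [F, Finset.sum_apply, Pi.single_apply, Finset.sum_ite_eq]
      rw [hx]
      exact (convex_convexHull ℝ _).sum_mem (fun a _ => h0 a) hsum fun a ha =>
        subset_convexHull ℝ _ (by simpa using ⟨a, ha, rfl⟩)

theorem nonneg [Finite A] (x : PosetRealization A) (a : A) : 0 ≤ x.1 a := by
  have := Fintype.ofFinite A
  exact (mem_space_iff.1 x.2).1 a

theorem sum_eq_one [Fintype A] (x : PosetRealization A) : ∑ a, x.1 a = 1 :=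
  (mem_space_iff.1 x.2).2.1

theorem le_or_le [Finite A] (x : PosetRealization A) {a b : A} (ha : x.1 a ≠ 0) (hb : x.1 b ≠ 0) :
    a ≤ b ∨ b ≤ a := by
  have := Fintype.ofFinite A
  exact (mem_space_iff.1 x.2).2.2.total ha hb

open Classical in
theorem vertex_apply [Finite A] (a b : A) : (vertex a).1 b = if b = a then 1 else 0 := by
  simp [vertex, Pi.single_apply]

/-! ### Functoriality -/

open Classical in
/-- The map of realizations induced by a monotone map: push-forward of probability vectors. -/
noncomputable def map [Fintype A] [Finite C] (f : A →o C) :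
    C(PosetRealization A, PosetRealization C) where
  toFun x := ⟨fun c => ∑ a, if f a = c then x.1 a else 0, by
    have := Fintype.ofFinite C
    refine mem_space_iff.2 ⟨fun c => sum_nonneg fun a _ => ?_, ?_, ?_⟩
    · split_ifs
      exacts [x.nonneg a, le_rfl]
    · rw [sum_comm]
      simpa using x.sum_eq_one
    · have supp : ∀ c, (∑ a, if f a = c then x.1 a else 0) ≠ 0 → ∃ a, f a = c ∧ x.1 a ≠ 0 := by
        intro c hc
        obtain ⟨a, -, ha⟩ := exists_ne_zero_of_sum_ne_zero hc
        exact ⟨a, by simpa using ha⟩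
      intro c hc c' hc' _
      obtain ⟨a, rfl, ha⟩ := supp c hc
      obtain ⟨a', rfl, ha'⟩ := supp c' hc'
      exact (x.le_or_le ha ha').imp (fun h => f.monotone h) fun h => f.monotone h⟩
  continuous_toFun := by
    refine Continuous.subtype_mk (continuous_pi fun c => continuous_finsetSum _ fun a _ => ?_) _
    split_ifs
    · exact (continuous_apply a).comp continuous_subtype_val
    · exact continuous_const

open Classical in
theorem map_apply [Fintype A] [Finite C] (f : A →o C) (x : PosetRealization A) (c : C) :
    (map f x).1 c = ∑ a, if f a = c then x.1 a else 0 := rfl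

theorem map_id [Fintype A] (f : A →o A) (hf : ∀ a, f a = a) (x : PosetRealization A) :
    map f x = x := by
  classical
  ext c; simp only [map_apply, hf, sum_ite_eq', mem_univ, if_true]

theorem map_map [Fintype A] [Fintype B] [Finite C] (f : A →o B) (g : B →o C)
    (x : PosetRealization A) : map g (map f x) = map (g.comp f) x := by
  classical
  ext c
  simp only [map_apply, OrderHom.comp_coe, Function.comp_apply]
  have h : ∀ b, (if g b = c then ∑ a, (if f a = b then x.1 a else 0) else 0) =
      ∑ a, if f a = b then (if g (f a) = c then x.1 a else 0) else 0 := fun b => by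
    split_ifs with hb
    · refine sum_congr rfl fun a _ => ?_
      split_ifs with h1 h2
      exacts [rfl, absurd (h1 ▸ hb) h2, rfl]
    · refine (sum_eq_zero fun a _ => ?_).symm
      split_ifs with h1 h2
      exacts [absurd (h1 ▸ h2) hb, rfl, rfl]
  rw [sum_congr rfl fun b _ => h b, sum_comm]
  simp

theorem map_vertex [Fintype A] [Finite C] (f : A →o C) (a : A) :
    map f (vertex a) = vertex (f a) := by
  classical
  ext c
  simp only [map_apply, vertex_apply]
  have h : ∀ b, (if f b = c then (if b = a then (1 : ℝ) else 0) else 0) =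
      if b = a then (if c = f a then 1 else 0) else 0 := fun b => by
    by_cases hb : b = a
    · subst hb; simp [eq_comm]
    · simp [hb]
  simp [h]

/-! ### Comonotone couplings and products -/

open Classical in
/-- The total weight of the elements below `a`, including `a`. -/
noncomputable def cumLE [Fintype A] (x : A → ℝ) (a : A) : ℝ := ∑ a', if a' ≤ a then x a' else 0

open Classical in
/-- The total weight of the elements strictly below `a`. -/
noncomputable def cumLT [Fintype A] (x : A → ℝ) (a : A) : ℝ := ∑ a', if a' < a then x a' else 0

theorem continuous_cumLE [Fintype A] (a : A) : Continuous fun x : A → ℝ => cumLE x a :=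
  continuous_finsetSum _ fun a' _ => by split_ifs <;> fun_prop

theorem continuous_cumLT [Fintype A] (a : A) : Continuous fun x : A → ℝ => cumLT x a :=
  continuous_finsetSum _ fun a' _ => by split_ifs <;> fun_prop

theorem cumLE_eq_add [Fintype A] (x : A → ℝ) (a : A) : cumLE x a = cumLT x a + x a := by
  classical
  have h : ∀ a', (if a' ≤ a then x a' else 0) =
      (if a' < a then x a' else 0) + if a' = a then x a' else 0 := fun a' => by
    by_cases h : a' = a
    · subst h; simp
    · simp [h, le_iff_lt_or_eq]
  simp only [cumLE, cumLT, h, sum_add_distrib]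
  simp

theorem cumLT_nonneg [Fintype A] (x : PosetRealization A) (a : A) : 0 ≤ cumLT x.1 a :=
  sum_nonneg fun a' _ => by
    split_ifs
    exacts [x.nonneg a', le_rfl]

theorem cumLE_le_one [Fintype A] (x : PosetRealization A) (a : A) : cumLE x.1 a ≤ 1 := by
  rw [← x.sum_eq_one]
  refine sum_le_sum fun a' _ => ?_
  split_ifs
  exacts [le_rfl, x.nonneg a']

theorem cumLE_le_cumLT [Fintype A] (x : PosetRealization A) {a a' : A} (h : a < a') :
    cumLE x.1 a ≤ cumLT x.1 a' := by
  refine sum_le_sum fun b _ => ?_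
  have := x.nonneg b
  split_ifs with h1 h2
  exacts [le_rfl, absurd (h1.trans_lt h) h2, this, le_rfl]

/-- Partial sums along a finite chain telescope; proved by removing the greatest element. -/
theorem sum_telescope_chain {A : Type*} [PartialOrder A] [DecidableLE A] [DecidableLT A]
    (x : A → ℝ) (φ : ℝ → ℝ) (S : Finset A) (hS : IsChain (· ≤ ·) (S : Set A)) :
    ∑ a ∈ S, (φ (∑ a' ∈ S with a' ≤ a, x a') - φ (∑ a' ∈ S with a' < a, x a')) =
      φ (∑ a ∈ S, x a) - φ 0 := by
  classical
  induction S using Finset.strongInduction with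
  | H S ih =>
    rcases S.eq_empty_or_nonempty with rfl | hne
    · simp
    obtain ⟨m, hm⟩ := S.exists_maximal hne
    have hle : ∀ a ∈ S, a ≤ m := fun a ha =>
      (hS.total ha hm.1).elim id fun h => hm.2 ha h
    have hm' := hm.1
    have h1 : S.filter (· ≤ m) = S := filter_true_of_mem hle
    have h2 : S.filter (· < m) = S.erase m := by
      ext a; simp only [mem_filter, mem_erase, and_comm, and_congr_left_iff]
      exact fun ha => ⟨fun h => h.ne, fun h => (hle a ha).lt_of_ne h⟩
    have h3 : ∀ a ∈ S.erase m, S.filter (· ≤ a) = (S.erase m).filter (· ≤ a) := fun a ha => by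
      obtain ⟨ha1, ha2⟩ := mem_erase.1 ha
      ext b
      simp only [mem_filter, mem_erase]
      refine ⟨fun h => ⟨⟨?_, h.1⟩, h.2⟩, fun h => ⟨h.1.2, h.2⟩⟩
      rintro rfl
      exact ha1 (le_antisymm (hle a ha2) h.2)
    have h4 : ∀ a ∈ S.erase m, S.filter (· < a) = (S.erase m).filter (· < a) := fun a ha => by
      obtain ⟨ha1, ha2⟩ := mem_erase.1 ha
      ext b
      simp only [mem_filter, mem_erase]
      refine ⟨fun h => ⟨⟨?_, h.1⟩, h.2⟩, fun h => ⟨h.1.2, h.2⟩⟩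
      rintro rfl
      exact ha1 (le_antisymm (hle a ha2) h.2.le)
    have h5 : ∑ a ∈ S.erase m, (φ (∑ a' ∈ S with a' ≤ a, x a') - φ (∑ a' ∈ S with a' < a, x a')) =
        φ (∑ a ∈ S.erase m, x a) - φ 0 := by
      rw [← ih _ (erase_ssubset hm') (hS.mono (by simp))]
      exact sum_congr rfl fun a ha => by rw [h3 a ha, h4 a ha]
    rw [← add_sum_erase S _ hm', h1, h2, h5]
    ring

/-- The intervals `[cumLT x a, cumLE x a]` of the support tile `[0, 1]`. -/
theorem sum_telescope [Fintype A] (x : PosetRealization A) (φ : ℝ → ℝ) :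
    ∑ a, (φ (cumLE x.1 a) - φ (cumLT x.1 a)) = φ 1 - φ 0 := by
  classical
  let S : Finset A := univ.filter fun a => x.1 a ≠ 0
  have hS : IsChain (· ≤ ·) (S : Set A) := fun a ha b hb _ =>
    x.le_or_le (by simpa [S] using ha) (by simpa [S] using hb)
  have h := sum_telescope_chain x.1 φ S hS
  have e (p : A → Prop) : ∑ a ∈ S with p a, x.1 a = ∑ a, if p a then x.1 a else 0 := by
    rw [filter_comm, sum_filter_ne_zero, sum_filter]
  have e1 : ∀ a, ∑ a' ∈ S with a' ≤ a, x.1 a' = cumLE x.1 a := fun a => e _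
  have e2 : ∀ a, ∑ a' ∈ S with a' < a, x.1 a' = cumLT x.1 a := fun a => e _
  simp only [e1, e2] at h
  rw [show ∑ a ∈ S, x.1 a = 1 by rw [← x.sum_eq_one, sum_filter_ne_zero]] at h
  rw [← h]
  refine (sum_subset (subset_univ _) fun a _ ha => ?_).symm
  rw [cumLE_eq_add, show x.1 a = 0 by simpa [S] using ha]
  simp

/-- The comonotone coupling of two probability vectors: the weight of `(a, b)` is the length of
`[cumLT x a, cumLE x a] ∩ [cumLT y b, cumLE y b]`. -/
noncomputable def coupling [Fintype A] [Fintype B] (x : A → ℝ) (y : B → ℝ) (p : A × B) : ℝ :=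
  max 0 (min (cumLE x p.1) (cumLE y p.2) - max (cumLT x p.1) (cumLT y p.2))

theorem coupling_comm [Fintype A] [Fintype B] (x : A → ℝ) (y : B → ℝ) (a : A) (b : B) :
    coupling x y (a, b) = coupling y x (b, a) := by
  simp only [coupling, min_comm, max_comm]

/-- The first marginal of the coupling of `x` and `y` is `x`: clamping to `[cumLT x a, cumLE x a]` turns
the intersection lengths into increments, which telescope over the tiling given by `y`. -/
theorem sum_coupling_right [Fintype A] [Fintype B] (x : PosetRealization A)
    (y : PosetRealization B) (a : A) : ∑ b, coupling x.1 y.1 (a, b) = x.1 a := by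
  have hx := x.nonneg a
  have hxl := cumLT_nonneg x a
  have hxu := cumLE_le_one x a
  have hxa := cumLE_eq_add x.1 a
  have h := sum_telescope y fun t => max (cumLT x.1 a) (min (cumLE x.1 a) t)
  rw [min_eq_left hxu, min_eq_right (by linarith), max_eq_left hxl, max_eq_right (by linarith)] at h
  rw [show x.1 a = cumLE x.1 a - cumLT x.1 a by linarith, ← h]
  refine sum_congr rfl fun b _ => ?_
  have hy := y.nonneg b
  have hyb := cumLE_eq_add y.1 b
  simp only [coupling]
  grind

theorem sum_coupling_left [Fintype A] [Fintype B] (x : PosetRealization A)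
    (y : PosetRealization B) (b : B) : ∑ a, coupling x.1 y.1 (a, b) = y.1 b := by
  simp only [coupling_comm x.1]
  exact sum_coupling_right y x b

theorem coupling_nonneg [Fintype A] [Fintype B] (x : A → ℝ) (y : B → ℝ) (p : A × B) :
    0 ≤ coupling x y p := le_max_left _ _

theorem left_ne_zero_of_coupling_ne_zero [Fintype A] [Fintype B] (x : PosetRealization A)
    (y : PosetRealization B) {p : A × B} (h : coupling x.1 y.1 p ≠ 0) : x.1 p.1 ≠ 0 := fun h0 => by
  rw [← sum_coupling_right x y p.1, sum_eq_zero_iff_of_nonneg fun _ _ => coupling_nonneg ..] at h0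
  exact h (h0 p.2 (mem_univ _))

theorem right_ne_zero_of_coupling_ne_zero [Fintype A] [Fintype B] (x : PosetRealization A)
    (y : PosetRealization B) {p : A × B} (h : coupling x.1 y.1 p ≠ 0) : y.1 p.2 ≠ 0 :=
  left_ne_zero_of_coupling_ne_zero y x (p := p.swap) (by rwa [Prod.swap, ← coupling_comm])

theorem cumLT_lt_of_coupling_ne_zero [Fintype A] [Fintype B] {x : A → ℝ} {y : B → ℝ} {p : A × B}
    (h : coupling x y p ≠ 0) : cumLT x p.1 < cumLE y p.2 ∧ cumLT y p.2 < cumLE x p.1 := by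
  have h' : 0 < coupling x y p := lt_of_le_of_ne (coupling_nonneg ..) h.symm
  simp only [coupling, lt_max_iff, lt_irrefl, false_or, sub_pos, max_lt_iff, lt_min_iff] at h'
  exact ⟨h'.2.1, h'.1.2⟩

/-- The coupling is supported on a chain of the product order: incomparable pairs `(a, b)`, `(a', b')`
with `a < a'` and `b' < b` would need intervals in the opposite order. -/
theorem coupling_mem_space [Fintype A] [Fintype B] (x : PosetRealization A)
    (y : PosetRealization B) : coupling x.1 y.1 ∈ (orderComplex (A × B)).geometric.space := by
  refine mem_space_iff.2 ⟨coupling_nonneg _ _, ?_, ?_⟩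
  · rw [Fintype.sum_prod_type]
    simp only [sum_coupling_right, sum_eq_one]
  · have no_cross : ∀ p q : A × B, coupling x.1 y.1 p ≠ 0 → coupling x.1 y.1 q ≠ 0 →
        p.1 < q.1 → q.2 < p.2 → False := fun p q hp hq h1 h2 => by
      have e1 := cumLE_le_cumLT x h1
      have e2 := cumLE_le_cumLT y h2
      have e3 := (cumLT_lt_of_coupling_ne_zero hp).2
      have e4 := (cumLT_lt_of_coupling_ne_zero hq).1
      linarith
    intro p hp q hq _
    have h1 := x.le_or_le (left_ne_zero_of_coupling_ne_zero x y hp)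
      (left_ne_zero_of_coupling_ne_zero x y hq)
    have h2 := y.le_or_le (right_ne_zero_of_coupling_ne_zero x y hp)
      (right_ne_zero_of_coupling_ne_zero x y hq)
    have c1 := no_cross p q hp hq
    have c2 := no_cross q p hq hp
    simp only [Prod.le_def]
    rcases h1 with h1 | h1 <;> rcases h2 with h2 | h2
    · exact Or.inl ⟨h1, h2⟩
    · rcases h1.eq_or_lt with e1 | e1
      · exact Or.inr ⟨e1.ge, h2⟩
      rcases h2.eq_or_lt with e2 | e2
      · exact Or.inl ⟨h1, e2.ge⟩
      exact (c1 e1 e2).elim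
    · rcases h1.eq_or_lt with e1 | e1
      · exact Or.inl ⟨e1.ge, h2⟩
      rcases h2.eq_or_lt with e2 | e2
      · exact Or.inr ⟨h1, e2.ge⟩
      exact (c2 e1 e2).elim
    · exact Or.inr ⟨h1, h2⟩

/-- The comonotone coupling as a continuous map `|A| × |B| → |A × B|`. -/
noncomputable def pair [Fintype A] [Fintype B] :
    C(PosetRealization A × PosetRealization B, PosetRealization (A × B)) where
  toFun z := ⟨coupling z.1.1 z.2.1, coupling_mem_space z.1 z.2⟩
  continuous_toFun := by
    refine Continuous.subtype_mk (continuous_pi fun p => ?_) _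
    have h1 := continuous_cumLE (A := A) p.1
    have h2 := continuous_cumLE (A := B) p.2
    have h3 := continuous_cumLT (A := A) p.1
    have h4 := continuous_cumLT (A := B) p.2
    have c1 : Continuous fun z : PosetRealization A × PosetRealization B => z.1.1 := by fun_prop
    have c2 : Continuous fun z : PosetRealization A × PosetRealization B => z.2.1 := by fun_prop
    exact continuous_const.max (((h1.comp c1).min (h2.comp c2)).sub ((h3.comp c1).max (h4.comp c2)))

theorem pair_apply [Fintype A] [Fintype B] (x : PosetRealization A) (y : PosetRealization B)
    (p : A × B) : (pair (x, y)).1 p = coupling x.1 y.1 p := rfl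

/-- The inclusion of the slice `A × {b}`. -/
def sliceLeft (A : Type*) {B : Type*} [PartialOrder A] [PartialOrder B] (b : B) : A →o A × B :=
  ⟨fun a => (a, b), fun _ _ h => ⟨h, le_rfl⟩⟩

/-- The inclusion of the slice `{a} × B`. -/
def sliceRight {A : Type*} (B : Type*) [PartialOrder A] [PartialOrder B] (a : A) : B →o A × B :=
  ⟨fun b => (a, b), fun _ _ h => ⟨le_rfl, h⟩⟩

/-- The diagonal. -/
def diagonal (A : Type*) [PartialOrder A] : A →o A × A :=
  ⟨fun a => (a, a), fun _ _ h => ⟨h, h⟩⟩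

@[simp]
theorem sliceLeft_apply (b : B) (a : A) : sliceLeft A b a = (a, b) := rfl

@[simp]
theorem sliceRight_apply (a : A) (b : B) : sliceRight B a b = (a, b) := rfl

@[simp]
theorem diagonal_apply (a : A) : diagonal A a = (a, a) := rfl

theorem pair_vertex_right [Fintype A] [Fintype B] (x : PosetRealization A) (b : B) :
    pair (x, vertex b) = map (sliceLeft A b) x := by
  classical
  ext ⟨a, b'⟩
  have h0 : ∀ b' ≠ b, ∀ a, coupling x.1 (vertex b).1 (a, b') = 0 := fun b' hb a => by
    by_contra h
    exact right_ne_zero_of_coupling_ne_zero x (vertex b) h (by simp [vertex_apply, hb])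
  simp only [pair_apply, map_apply, sliceLeft_apply, Prod.mk.injEq]
  by_cases hb : b' = b
  · subst hb
    simp only [and_true, sum_ite_eq', mem_univ, if_true]
    rw [← sum_coupling_right x (vertex b') a]
    exact (sum_eq_single b' (fun c _ hc => h0 c hc a) (by simp)).symm
  · simp [h0 b' hb, Ne.symm hb]

theorem pair_vertex_left [Fintype A] [Fintype B] (a : A) (y : PosetRealization B) :
    pair (vertex a, y) = map (sliceRight B a) y := by
  classical
  ext ⟨a', b⟩
  have h0 : ∀ a' ≠ a, ∀ b, coupling (vertex a).1 y.1 (a', b) = 0 := fun a' ha b => by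
    by_contra h
    exact left_ne_zero_of_coupling_ne_zero (vertex a) y h (by simp [vertex_apply, ha])
  simp only [pair_apply, map_apply, sliceRight_apply, Prod.mk.injEq]
  by_cases ha : a' = a
  · subst ha
    simp only [true_and, sum_ite_eq', mem_univ, if_true]
    rw [← sum_coupling_left (vertex a') y b]
    exact (sum_eq_single a' (fun c _ hc => h0 c hc b) (by simp)).symm
  · simp [h0 a' ha, Ne.symm ha]

theorem pair_self [Fintype A] (x : PosetRealization A) : pair (x, x) = map (diagonal A) x := by
  classical
  ext ⟨a, a'⟩
  simp only [pair_apply, map_apply, diagonal_apply, Prod.mk.injEq]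
  by_cases h : a = a'
  · subst h
    have := cumLE_eq_add x.1 a
    have := x.nonneg a
    simp only [and_self, sum_ite_eq', mem_univ, if_true, coupling, min_self, max_self]
    rw [max_eq_right (by linarith)]
    linarith
  · have h0 : coupling x.1 x.1 (a, a') = 0 := by
      by_contra hne
      obtain ⟨h1, h2⟩ := cumLT_lt_of_coupling_ne_zero hne
      rcases x.le_or_le (left_ne_zero_of_coupling_ne_zero x x hne)
        (right_ne_zero_of_coupling_ne_zero x x hne) with hle | hle
      · exact (cumLE_le_cumLT x (lt_of_le_of_ne hle h)).not_gt h2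
      · exact (cumLE_le_cumLT x (lt_of_le_of_ne hle (Ne.symm h))).not_gt h1
    rw [h0]
    refine (sum_eq_zero fun c _ => if_neg ?_).symm
    rintro ⟨rfl, rfl⟩
    exact h rfl

end PosetRealization

/-! ### Homotopies from comparable monotone maps -/

namespace PosetRealization

open scoped unitInterval Topology.Homotopy
open Finset GenLoop

variable {A B C P : Type*} [PartialOrder A] [PartialOrder B] [PartialOrder C] [PartialOrder P]
variable {N : Type*}

/-- All `N`-dimensional loops of the realization based at vertices are null homotopic. -/
def LoopsTrivial (N P : Type*) [PartialOrder P] [Finite P] : Prop :=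
  ∀ (p : P) (γ : Ω^ N (PosetRealization P) (vertex p)), Homotopic γ const

/-- The edge of the realization of `{0 < 1}`. -/
noncomputable def edge : C(I, PosetRealization (Fin 2)) where
  toFun s := ⟨![1 - s, s], mem_space_iff.2 ⟨fun i => by
    have := s.2.1
    have := s.2.2
    fin_cases i <;> simpa, by simp, fun i _ j _ _ => le_total i j⟩⟩
  continuous_toFun := Continuous.subtype_mk (continuous_pi fun i => by
    fin_cases i <;> simp <;> fun_prop) _

theorem edge_zero : edge 0 = vertex 0 := by
  ext i; fin_cases i <;> simp [edge, vertex_apply]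

theorem edge_one : edge 1 = vertex 1 := by
  ext i; fin_cases i <;> simp [edge, vertex_apply]

/-- Pointwise comparable monotone maps induce homotopic maps of realizations, through the monotone
map they define on the product with `{0 < 1}`. -/
theorem homotopicWith_of_le [Fintype A] [Finite C] {f g : A →o C} (h : ∀ a, f a ≤ g a)
    {γ : C(I^N, PosetRealization A)} (hγ : ConstOnBoundary γ) :
    ((map f).comp γ).HomotopicWith ((map g).comp γ) ConstOnBoundary := by
  let b : A × Fin 2 →o C :=
    { toFun := fun p => if p.2 = 0 then f p.1 else g p.1
      monotone' := fun p q hpq => by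
        have h1 := f.monotone hpq.1
        have h2 := g.monotone hpq.1
        have h3 := h q.1
        have h4 : q.2 = 0 → p.2 = 0 := fun hq => le_antisymm (hq ▸ hpq.2) (Fin.zero_le _)
        dsimp only
        split_ifs with hp hq hq
        exacts [h1, h1.trans h3, absurd (h4 hq) hp, h2] }
  have hb : ∀ y i, map b (pair (γ y, vertex i)) = map (b.comp (sliceLeft A i)) (γ y) := fun y i => by
    rw [pair_vertex_right, map_map]
  refine ⟨⟨⟨⟨fun p => map b (pair (γ p.2, edge p.1)), by fun_prop⟩, fun y => ?_, fun y => ?_⟩,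
    fun s => ?_⟩⟩
  · change map b (pair (γ y, edge 0)) = map f (γ y)
    rw [edge_zero, hb]
    congr 1
  · change map b (pair (γ y, edge 1)) = map g (γ y)
    rw [edge_one, hb]
    congr 1
  · obtain ⟨a, ha⟩ := hγ
    exact ⟨map b (pair (a, edge s)), fun y hy => by
      change map b (pair (γ y, edge s)) = _
      rw [ha y hy]⟩

/-! ### Retractions onto fixed points -/

/-- The corestriction of an idempotent monotone map to its fixed points. -/
def toFixed (q : P →o P) (hq : ∀ x, q (q x) = q x) : P →o {x // q x = x} :=
  ⟨fun x => ⟨q x, hq x⟩, fun _ _ h => q.monotone h⟩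

/-- A map onto a subset with trivial loops kills all loops. -/
theorem homotopic_const_map_idempotent [Fintype P] {q : P →o P} (hq : ∀ x, q (q x) = q x)
    (hQ : LoopsTrivial N {x // q x = x}) {p p' : P} (h : map q (vertex p) = vertex p')
    (γ : Ω^ N (PosetRealization P) (vertex p)) : Homotopic (GenLoop.map (map q) h γ) const := by
  have := Fintype.ofFinite {x // q x = x}
  let i : {x // q x = x} →o P := OrderHom.Subtype.val _
  have h := (hQ _ (GenLoop.map (map (toFixed q hq)) (map_vertex _ p) γ)).map_const (map i)
    ((map_vertex i _).trans ((map_vertex q p).symm.trans h))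
  convert! h using 1
  ext1 y
  exact (map_map (toFixed q hq) i (γ y)).symm

/-- A loop that is null homotopic after a map freely homotopic to the identity is null homotopic. -/
theorem homotopic_const_of_homotopicWith [Finite P] [Finite N] [Nonempty N] {p p' : P}
    {γ : Ω^ N (PosetRealization P) (vertex p)} {γ' : Ω^ N (PosetRealization P) (vertex p')}
    (h : γ.1.HomotopicWith γ'.1 ConstOnBoundary) (h' : Homotopic γ' const) : Homotopic γ const := by
  obtain ⟨F⟩ := h
  obtain ⟨G⟩ := h'
  let G' : γ'.1.HomotopyWith (ContinuousMap.const _ (vertex p')) ConstOnBoundary :=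
    ⟨G.toHomotopy, fun s => ⟨vertex p', fun y hy => (G.eq_fst s hy).trans (γ'.2 y hy)⟩⟩
  exact homotopic_const_of_homotopyWith (F.trans G')

/-- If all proper retracts of `P` have trivial loops and `P` is not a core, then `P` has trivial
loops. -/
theorem loopsTrivial_of_not_isCore [Finite P] [Finite N] [Nonempty N]
    (hQ : ∀ q : P →o P, (∀ x, q (q x) = q x) → (∃ x, q x ≠ x) → LoopsTrivial N {x // q x = x})
    (hP : ¬ FinitePoset.IsCore P) : LoopsTrivial N P := by
  have := Fintype.ofFinite P
  obtain ⟨g, hg, x, hx⟩ : ∃ g : P →o P, ((∀ x, x ≤ g x) ∨ ∀ x, g x ≤ x) ∧ ∃ x, g x ≠ x := by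
    simpa [FinitePoset.IsCore] using hP
  obtain ⟨k, hk, hidem⟩ := exists_pow_idempotent g
  obtain ⟨k, rfl⟩ := Nat.exists_eq_succ_of_ne_zero hk.ne'
  have hq : ∀ x, (g ^ (k + 1)) ((g ^ (k + 1)) x) = (g ^ (k + 1)) x := fun x =>
    DFunLike.congr_fun hidem x
  have hsucc : ∀ m x, (g ^ (m + 1)) x = (g ^ m) (g x) := fun m x =>
    DFunLike.congr_fun (pow_succ g m) x
  have triv : ∀ p (γ : Ω^ N (PosetRealization P) (vertex p)), (g ^ (k + 1)) x ≠ x →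
      Homotopic (GenLoop.map (map (g ^ (k + 1))) (map_vertex _ p) γ) const := fun p γ hx =>
    homotopic_const_map_idempotent hq (hQ _ hq ⟨x, hx⟩) _ γ
  have hid : ∀ γ : C(I^N, PosetRealization P), (map OrderHom.id).comp γ = γ := fun γ => by
    ext1 y; exact map_id _ (fun _ => rfl) _
  intro p γ
  have hγ : ConstOnBoundary γ.1 := ⟨_, γ.2⟩
  rcases hg with hg | hg
  · have hpow : ∀ m x, x ≤ (g ^ m) x := fun m => by
      induction m with
      | zero => exact fun x => le_rfl
      | succ m ih => exact fun x => (hg x).trans ((ih _).trans_eq (hsucc m x).symm)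
    refine homotopic_const_of_homotopicWith ?_ (triv p γ fun h => hx ?_)
    · simpa only [hid] using! homotopicWith_of_le (f := OrderHom.id) (hpow (k + 1)) hγ
    · exact le_antisymm (((hpow k _).trans_eq (hsucc k x).symm).trans_eq h) (hg x)
  · have hpow : ∀ m x, (g ^ m) x ≤ x := fun m => by
      induction m with
      | zero => exact fun x => le_rfl
      | succ m ih => exact fun x => (hsucc m x).le.trans ((ih _).trans (hg x))
    refine homotopic_const_of_homotopicWith ?_ (triv p γ fun h => hx ?_)
    · obtain ⟨F⟩ := homotopicWith_of_le (g := OrderHom.id) (hpow (k + 1)) hγ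
      exact ⟨(F.symm).cast (hid _) rfl⟩
    · exact le_antisymm (hg x) (h.symm.le.trans ((hsucc k x).le.trans (hpow k _)))

open Classical in
/-- A loop based in a set `U` that is both upward and downward closed stays in the part of the
realization spanned by `U`: the total weight of `U` is a continuous function with values
in `{0, 1}`. -/
theorem apply_eq_zero_of_notMem [Fintype P] [Nonempty N] {U : Set P}
    (hU : ∀ x y, x ≤ y → (x ∈ U ↔ y ∈ U)) {p : P} (hp : p ∈ U)
    (γ : Ω^ N (PosetRealization P) (vertex p)) (y : I^N) {a : P} (ha : a ∉ U) :
    (γ y).1 a = 0 := by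
  let S : PosetRealization P → ℝ := fun x => ∑ a, if a ∈ U then x.1 a else 0
  have hS : Continuous S := continuous_finsetSum _ fun a _ => by
    split_ifs
    exacts [(continuous_apply a).comp continuous_subtype_val, continuous_const]
  have h_one : ∀ x : PosetRealization P, ∀ b ∈ U, x.1 b ≠ 0 → ∀ a ∉ U, x.1 a = 0 := by
    intro x b hb hxb a ha
    by_contra hxa
    rcases x.le_or_le hxa hxb with h | h
    · exact ha ((hU _ _ h).2 hb)
    · exact ha ((hU _ _ h).1 hb)
  have hS01 : ∀ x, S x = 0 ∨ S x = 1 := fun x => by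
    by_cases h : ∃ b ∈ U, x.1 b ≠ 0
    · obtain ⟨b, hb, hxb⟩ := h
      right
      rw [← x.sum_eq_one]
      refine sum_congr rfl fun a _ => ?_
      split_ifs with ha
      exacts [rfl, (h_one x b hb hxb a ha).symm]
    · push Not at h
      exact Or.inl (sum_eq_zero fun a _ => by split_ifs with ha; exacts [h a ha, rfl])
  have hSp : S (γ 0) = 1 := by
    have : γ 0 = vertex p := γ.2 0 ⟨Classical.arbitrary N, Or.inl rfl⟩
    rw [this]
    simp only [S, vertex_apply]
    rw [sum_eq_single p] <;> simp +contextual [hp]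
  have hSy : S (γ y) = 1 := by
    refine (hS01 _).resolve_left fun h0 => ?_
    obtain ⟨z, hz⟩ := mem_range_of_exists_le_of_exists_ge (c := (1 / 2 : ℝ))
      (hS.comp γ.1.continuous) ⟨y, by simp [h0]⟩ ⟨0, by simp [hSp]; norm_num⟩
    have hz' : S (γ z) = 1 / 2 := hz
    rcases hS01 (γ z) with h | h <;> norm_num [h] at hz'
  obtain ⟨b, -, hb⟩ := exists_ne_zero_of_sum_ne_zero (hSy.trans_ne one_ne_zero)
  have hbU : b ∈ U := by by_contra h; simp [h] at hb
  exact h_one _ b hbU (by simpa [hbU] using hb) a ha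

/-- If all proper retracts of `P` have trivial loops, then every loop of `P` is null homotopic
unless `P` is connected: otherwise the other components can be collapsed to the base point. -/
theorem homotopic_const_of_not_connectedFrom [Finite P] [Nonempty N]
    (hQ : ∀ q : P →o P, (∀ x, q (q x) = q x) → (∃ x, q x ≠ x) → LoopsTrivial N {x // q x = x})
    {p : P} (hP : ¬ FinitePoset.ConnectedFrom p) (γ : Ω^ N (PosetRealization P) (vertex p)) :
    Homotopic γ const := by
  classical
  have := Fintype.ofFinite P
  obtain ⟨U, hp, hU, x, hx⟩ : ∃ U : Set P, p ∈ U ∧ (∀ x y, x ≤ y → (x ∈ U ↔ y ∈ U)) ∧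
      ∃ x, x ∉ U := by simpa [FinitePoset.ConnectedFrom] using hP
  let q : P →o P :=
    { toFun := fun x => if x ∈ U then x else p
      monotone' := fun x y h => by
        dsimp only
        by_cases hx : x ∈ U
        · simpa [hx, (hU x y h).1 hx] using h
        · simp [hx, mt (hU x y h).2 hx] }
  have hqU : ∀ x ∈ U, q x = x := fun x hx => if_pos hx
  have hqU' : ∀ x ∉ U, q x = p := fun x hx => if_neg hx
  have hq : ∀ x, q (q x) = q x := fun x => by
    by_cases hx : x ∈ U
    · rw [hqU x hx, hqU x hx]
    · rw [hqU' x hx, hqU p hp]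
  have hqx : q x ≠ x := by rw [hqU' x hx]; rintro rfl; exact hx hp
  have hmap : ∀ y, map q (γ y) = γ y := fun y => by
    ext c
    have h : ∀ a, (if q a = c then (γ y).1 a else 0) = if a = c then (γ y).1 a else 0 := fun a => by
      by_cases ha : a ∈ U
      · rw [hqU a ha]
      · simp [apply_eq_zero_of_notMem hU hp γ y ha]
    rw [map_apply]
    simp only [h, sum_ite_eq', mem_univ, if_true]
  have h := homotopic_const_map_idempotent hq (hQ q hq ⟨x, hqx⟩)
    ((map_vertex q p).trans (congrArg vertex (hqU p hp))) γ
  rwa [show GenLoop.map (map q) _ γ = γ from GenLoop.ext _ _ hmap] at h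

/-! ### Binary operations and the induction -/

theorem map_pow_apply [Fintype P] (f : P →o P) (k : ℕ) (x : PosetRealization P) :
    map (f ^ k) x = (map f)^[k] x := by
  induction k with
  | zero => exact map_id _ (fun _ => rfl) _
  | succ k ih => rw [Function.iterate_succ_apply', ← ih, map_map, pow_succ']; rfl

/-- If all proper retracts of `P` have trivial loops, then iterating a monotone map that is not
bijective kills all loops: some power is a retraction onto a proper subset. -/
theorem exists_iterate_homotopic_const [Fintype P]
    (hQ : ∀ q : P →o P, (∀ x, q (q x) = q x) → (∃ x, q x ≠ x) → LoopsTrivial N {x // q x = x})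
    {f : P →o P} (hbij : ¬ Function.Bijective f) {p : P} (hf : map f (vertex p) = vertex p) :
    ∃ k, ∀ γ : Ω^ N (PosetRealization P) (vertex p),
      Homotopic ((GenLoop.map (map f) hf)^[k] γ) const := by
  obtain ⟨k, hk, hidem⟩ := exists_pow_idempotent f
  have hne : ∃ x, (f ^ k) x ≠ x := by
    by_contra! h
    obtain ⟨k, rfl⟩ := Nat.exists_eq_succ_of_ne_zero hk.ne'
    refine hbij (Finite.injective_iff_bijective.1 fun x y hxy => ?_)
    rw [← h x, ← h y]
    exact congrArg (f ^ k) hxy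
  have hpow : map (f ^ k) (vertex p) = vertex p := by
    rw [map_pow_apply, Function.iterate_fixed hf]
  refine ⟨k, fun γ => ?_⟩
  have h := homotopic_const_map_idempotent (fun x => DFunLike.congr_fun hidem x)
    (hQ (f ^ k) (fun x => DFunLike.congr_fun hidem x) hne) hpow γ
  convert! h using 1
  ext1 y
  rw [GenLoop.iterate_map_apply, GenLoop.map_apply, map_pow_apply]

/-- If all proper retracts of `P` have trivial loops while some loop at `p` is not null homotopic,
then every binary idempotent operation has a translation by `p` that is an automorphism. -/
theorem bijective_or_bijective [Finite P] [Nonempty N]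
    (hQ : ∀ q : P →o P, (∀ x, q (q x) = q x) → (∃ x, q x ≠ x) → LoopsTrivial N {x // q x = x})
    {p : P} {γ : Ω^ N (PosetRealization P) (vertex p)} (hγ : ¬ Homotopic γ const)
    (b : P × P →o P) (hb : ∀ x, b (x, x) = x) :
    Function.Bijective (fun x => b (x, p)) ∨ Function.Bijective (fun x => b (p, x)) := by
  have := Fintype.ofFinite P
  by_contra! h
  let f : P →o P := b.comp (sliceLeft P p)
  let g : P →o P := b.comp (sliceRight P p)
  have hf : map f (vertex p) = vertex p := (map_vertex f p).trans (congrArg vertex (hb p))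
  have hg : map g (vertex p) = vertex p := (map_vertex g p).trans (congrArg vertex (hb p))
  obtain ⟨k, hk⟩ := exists_iterate_homotopic_const hQ (f := f) h.1 hf
  obtain ⟨l, hl⟩ := exists_iterate_homotopic_const hQ (f := g) h.2 hg
  refine hγ (homotopic_const_of_iterate (β := (map b).comp pair) (fun z => ?_) (fun z => ?_)
    (fun z => ?_) hf hg hk hl γ)
  · rw [ContinuousMap.comp_apply, pair_self, map_map]
    exact map_id _ hb z
  · rw [ContinuousMap.comp_apply, pair_vertex_right, map_map]
  · rw [ContinuousMap.comp_apply, pair_vertex_left, map_map]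

/-- Sub-Taylor polymorphisms pass to retracts. -/
def _root_.SubTaylorPolymorphism.fixed {n : ℕ} (T : SubTaylorPolymorphism P n) (q : P →o P)
    (hq : ∀ x, q (q x) = q x) : SubTaylorPolymorphism {x // q x = x} n where
  t := ⟨fun x => toFixed q hq (T.t fun i => (x i).1), fun _ _ h =>
    (toFixed q hq).monotone (T.t.monotone fun i => h i)⟩
  s i := ⟨fun x => toFixed q hq (T.s i fun i => (x i).1), fun _ _ h =>
    (toFixed q hq).monotone ((T.s i).monotone fun i => h i)⟩
  le_diag x := show x.1 ≤ q _ from x.2.symm.le.trans (q.monotone (T.le_diag x.1))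
  sub_taylor i := by
    obtain ⟨α, β, hαβ, h⟩ := T.sub_taylor i
    exact ⟨α, β, hαβ, fun x => ⟨q.monotone (h _).1, q.monotone (h _).2⟩⟩

/-- A finite poset with a sub-Taylor polymorphism has trivial loops, by induction on its size. -/
theorem loopsTrivial_of_subTaylorPolymorphism {P : Type*} [PartialOrder P] [Finite P] [Finite N]
    [Nonempty N] {n : ℕ} (T : SubTaylorPolymorphism P n) : LoopsTrivial N P := by
  induction h : Nat.card P using Nat.strong_induction_on generalizing P with
  | _ m ih =>
    have hQ : ∀ q : P →o P, (∀ x, q (q x) = q x) → (∃ x, q x ≠ x) →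
        LoopsTrivial N {x // q x = x} := fun q hq ⟨x, hx⟩ =>
      ih _ (h ▸ Finite.card_subtype_lt hx) (T.fixed q hq) rfl
    by_cases hcore : FinitePoset.IsCore P
    swap
    · exact loopsTrivial_of_not_isCore hQ hcore
    intro p γ
    by_contra hγ
    have hconn : FinitePoset.ConnectedFrom p := by
      by_contra hc
      exact hγ (homotopic_const_of_not_connectedFrom hQ hc γ)
    have := FinitePoset.subsingleton_of_isCore hcore hconn (bijective_or_bijective hQ hγ) T
    have hsub : ∀ x : PosetRealization P, x = vertex p := fun x => by
      have := Fintype.ofFinite P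
      ext a
      have h1 := x.sum_eq_one
      rw [Fintype.sum_subsingleton _ a] at h1
      rw [h1, vertex_apply, if_pos (Subsingleton.elim a p)]
    apply hγ
    rw [show γ = const from GenLoop.ext _ _ fun y => hsub _]

end PosetRealization

theorem mainTheorem3 {P : Type*} [PartialOrder P] [Finite P] {n : ℕ}
    (T : SubTaylorPolymorphism P n) (d : ℕ) (hd : 1 ≤ d) (p₀ : P) :
    Subsingleton (π_ d (PosetRealization P) (PosetRealization.vertex p₀)) := by
  have : NeZero d := ⟨by omega⟩
  have h := PosetRealization.loopsTrivial_of_subTaylorPolymorphism (N := Fin d) T p₀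
  refine ⟨fun a b => ?_⟩
  induction a using Quotient.inductionOn with | _ γ =>
  induction b using Quotient.inductionOn with | _ γ' =>
  exact Quotient.sound ((h γ).trans (h γ').symm)
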